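/- Let $n, m \ge 0$ be integers, let $Q \in \mathbb{R}^{n\times n}$ be a symmetric matrix, $\alpha \in \mathbb{R}^n$, $g \in \mathbb{R}$, $A \in \mathbb{R}^{m \times n}$ and $b \in \mathbb{R}^m$, and suppose that the polyhedron $P = \{x \in \mathbb{R}^n : Ax \le b\}$ is bounded. Let $$S = \{x \in \mathbb{R}^n : x^\top Q x + \alpha^\top x = g,\ x \in P\}.$$ Then the convex hull $\mathrm{conv}(S)$ is second-order cone representable. Here a set $X \subseteq \mathbb{R}^n$ is called second-order cone representable if there are integers $p, k \ge 0$ and $m_1, \dots, m_k \ge 0$ and affine maps $F_j : \mathbb{R}^n \times \mathbb{R}^p \to \mathbb{R}^{m_j} \times \mathbb{R}$, $j = 1, \dots, k$, such that $$X = \{x \in \mathbb{R}^n : \text{there is } u \in \mathbb{R}^p \text{ with } F_j(x,u) \in L_{m_j} \text{ for all } j = 1, \dots, k\},$$ where $L_m = \{(y,t) \in \mathbb{R}^m \times \mathbb{R} : \|y\|_2 \le t\}$ is the second-order (Lorentz) cone. -/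

import Mathlib

open scoped Matrix

/-- The second-order (Lorentz) cone `{(y, t) ∈ ℝᵐ × ℝ : ‖y‖₂ ≤ t}`. For `m = 0` it is the
half-line `t ≥ 0`, so that linear inequalities are second-order cone constraints. -/
def secondOrderCone (m : ℕ) : Set (EuclideanSpace ℝ (Fin m) × ℝ) :=
  {z | ‖z.1‖ ≤ z.2}

/-- A set `X ⊆ ℝⁿ` is second-order cone representable if it is the projection onto `ℝⁿ` of a set
in some `ℝⁿ × ℝᵖ` that is described by finitely many second-order cone constraints, each of which
requires the value of an affine map to lie in a second-order cone. -/
def IsSOCRepresentable {n : ℕ} (X : Set (Fin n → ℝ)) : Prop :=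
  ∃ (p k : ℕ) (m : Fin k → ℕ)
    (F : ∀ j : Fin k, ((Fin n → ℝ) × (Fin p → ℝ)) →ᵃ[ℝ] (EuclideanSpace ℝ (Fin (m j)) × ℝ)),
    X = {x | ∃ u : Fin p → ℝ, ∀ j : Fin k, F j (x, u) ∈ secondOrderCone (m j)}

/-!
Work face by face on `P`. If through every point of `S` on a face there is a line parallel to the
face and contained in the quadric, then every such point lies between two points of `S` on proper
subfaces, so the hull over the face is the hull of the finitely many hulls over those subfaces. The
convex hull of a union of two bounded sets is described by the cones over their hulls.

Otherwise some point `x₀` of `S` on the face admits no such line. In coordinates `v = x - x₀` the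
quadric is `q v + w v = 0` with `w` linear, and `q` is anisotropic, hence definite, on the
directions of the face in the kernel of `w`. By Finsler's lemma `q + μ w²` is positive definite for
some `μ` (after changing the sign of the equation), so on the face the quadric is
`‖L v‖² = w v * (μ * w v - 1)`, which is a union of two sets of the form `‖G x‖ = f x` with `G` and
`f` affine.

The set `‖G x‖ = f x` is the difference of the convex set `‖G x‖ ≤ f x` and its open convex subset
`U` given by `‖G x‖ < f x`. Its hull over the face is the intersection of the former with the hull
of the complement of `U`, and the latter is again found face by face: by Hahn–Banach a point outside
`U` lies on a hyperplane missing `U`, which contains a line parallel to the face unless the face is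
at most one-dimensional.
-/

theorem zero_mem_secondOrderCone (m : ℕ) : 0 ∈ secondOrderCone m := by
  simp [secondOrderCone]

theorem add_mem_secondOrderCone {m : ℕ} {y z : EuclideanSpace ℝ (Fin m) × ℝ}
    (hy : y ∈ secondOrderCone m) (hz : z ∈ secondOrderCone m) : y + z ∈ secondOrderCone m :=
  (norm_add_le _ _).trans (add_le_add hy hz)

theorem smul_mem_secondOrderCone {m : ℕ} {y : EuclideanSpace ℝ (Fin m) × ℝ} {c : ℝ} (hc : 0 ≤ c)
    (hy : y ∈ secondOrderCone m) : c • y ∈ secondOrderCone m := by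
  change ‖c • y.1‖ ≤ c * y.2
  rw [norm_smul, Real.norm_of_nonneg hc]
  exact mul_le_mul_of_nonneg_left hy hc

theorem smul_mem_secondOrderCone_iff {m : ℕ} {y : EuclideanSpace ℝ (Fin m) × ℝ} {c : ℝ}
    (hc : 0 < c) : c • y ∈ secondOrderCone m ↔ y ∈ secondOrderCone m :=
  ⟨fun h => by simpa [smul_smul, hc.ne'] using smul_mem_secondOrderCone (inv_nonneg.2 hc.le) h,
    smul_mem_secondOrderCone hc.le⟩

section Algebra

variable {E W : Type*} [AddCommGroup E] [Module ℝ E] [AddCommGroup W] [Module ℝ W]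

/-- Second-order cone representability of a set in an arbitrary real vector space; on `Fin n → ℝ`
it unfolds to `IsSOCRepresentable`. -/
def SOCRepresentable (X : Set E) : Prop :=
  ∃ (p k : ℕ) (m : Fin k → ℕ)
    (F : ∀ j : Fin k, (E × (Fin p → ℝ)) →ᵃ[ℝ] (EuclideanSpace ℝ (Fin (m j)) × ℝ)),
    X = {x | ∃ u : Fin p → ℝ, ∀ j : Fin k, F j (x, u) ∈ secondOrderCone (m j)}

/-- The linear map on `E × ℝ` that extends the affine map `F`, placed at height `1`. It turns the
constraints on a set into constraints on the cone over that set. -/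
def homogenization (F : E →ᵃ[ℝ] W) : E × ℝ →ₗ[ℝ] W :=
  F.linear.coprod (LinearMap.toSpanSingleton ℝ W (F 0))

theorem homogenization_smul (F : E →ᵃ[ℝ] W) (l : ℝ) (x : E) :
    homogenization F (l • x, l) = l • F x := by
  rw [F.decomp]
  simp [homogenization]

theorem homogenization_zero_right (F : E →ᵃ[ℝ] W) (x : E) :
    homogenization F (x, 0) = F.linear x := by
  simp [homogenization]

namespace SOCRepresentable

theorem setOf_exists_forall_mem [FiniteDimensional ℝ W] {ι : Type*} [Finite ι] (m : ι → ℕ)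
    (F : ∀ i, (E × W) →ᵃ[ℝ] (EuclideanSpace ℝ (Fin (m i)) × ℝ)) :
    SOCRepresentable {x : E | ∃ u : W, ∀ i, F i (x, u) ∈ secondOrderCone (m i)} := by
  obtain ⟨k, ⟨e⟩⟩ := Finite.exists_equiv_fin ι
  let f : W ≃ₗ[ℝ] (Fin (Module.finrank ℝ W) → ℝ) := (Module.finBasis ℝ W).equivFun
  refine ⟨_, k, m ∘ e.symm, fun j => (F (e.symm j)).comp
    ((AffineMap.id ℝ E).prodMap f.symm.toLinearMap.toAffineMap), Set.ext fun x => ⟨?_, ?_⟩⟩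
  · rintro ⟨u, hu⟩
    exact ⟨f u, fun j => by simpa using hu (e.symm j)⟩
  · rintro ⟨u, hu⟩
    exact ⟨f.symm u, e.symm.surjective.forall.2 hu⟩

theorem lorentzCone (m : ℕ) : SOCRepresentable (secondOrderCone m) := by
  convert setOf_exists_forall_mem (W := Unit → ℝ) (fun _ : Unit => m)
    fun _ => (LinearMap.fst ℝ (EuclideanSpace ℝ (Fin m) × ℝ) (Unit → ℝ)).toAffineMap using 1
  ext z
  simp

theorem preimage {X : Set W} (hX : SOCRepresentable X) (G : E →ᵃ[ℝ] W) :
    SOCRepresentable (G ⁻¹' X) := by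
  obtain ⟨p, k, m, F, rfl⟩ := hX
  exact ⟨p, k, m, fun j => (F j).comp (G.prodMap (AffineMap.id ℝ _)), rfl⟩

theorem image_fst [FiniteDimensional ℝ W] {X : Set (E × W)} (hX : SOCRepresentable X) :
    SOCRepresentable (Prod.fst '' X) := by
  obtain ⟨p, k, m, F, rfl⟩ := hX
  convert setOf_exists_forall_mem (E := E) (W := W × (Fin p → ℝ)) m (fun j => (F j).comp
    (LinearEquiv.prodAssoc ℝ E W (Fin p → ℝ)).symm.toLinearMap.toAffineMap) using 1
  ext x
  simp only [Set.mem_image, Prod.exists, exists_and_right, exists_eq_right]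
  rfl

theorem iInter {ι : Type*} [Finite ι] {X : ι → Set E} (hX : ∀ i, SOCRepresentable (X i)) :
    SOCRepresentable (⋂ i, X i) := by
  choose p k m F hF using hX
  convert setOf_exists_forall_mem (E := E) (W := ∀ i, Fin (p i) → ℝ)
    (fun j : Σ i, Fin (k i) => m j.1 j.2) (fun j => (F j.1 j.2).comp
      ((AffineMap.id ℝ E).prodMap (LinearMap.proj j.1).toAffineMap)) using 1
  ext x
  rw [Set.mem_iInter, Set.mem_ofPred_eq, forall_congr' fun i => Set.ext_iff.1 (hF i) x]
  simp only [Set.mem_ofPred_eq, Classical.skolem, Sigma.forall]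
  rfl

theorem inter {X Y : Set E} (hX : SOCRepresentable X) (hY : SOCRepresentable Y) :
    SOCRepresentable (X ∩ Y) := by
  rw [Set.inter_eq_iInter]
  exact iInter (Bool.rec hY hX)

theorem setOf_norm_le {F : Type*} [NormedAddCommGroup F] [InnerProductSpace ℝ F]
    [FiniteDimensional ℝ F] (G : E →ᵃ[ℝ] F) (f : E →ᵃ[ℝ] ℝ) :
    SOCRepresentable {x | ‖G x‖ ≤ f x} := by
  let e := (stdOrthonormalBasis ℝ F).repr
  convert (lorentzCone _).preimage ((e.toLinearMap.toAffineMap.comp G).prod f) using 1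
  ext x
  change ‖G x‖ ≤ f x ↔ ‖e (G x)‖ ≤ f x
  rw [e.norm_map]

theorem setOf_le (f g : E →ᵃ[ℝ] ℝ) : SOCRepresentable {x | f x ≤ g x} := by
  simpa using setOf_norm_le (0 : E →ᵃ[ℝ] ℝ) (g - f)

theorem setOf_eq (f g : E →ᵃ[ℝ] ℝ) : SOCRepresentable {x | f x = g x} := by
  simpa only [le_antisymm_iff, Set.ofPred_and] using (setOf_le f g).inter (setOf_le g f)

theorem empty : SOCRepresentable (∅ : Set E) := by
  convert setOf_le (AffineMap.const ℝ E (1 : ℝ)) (AffineMap.const ℝ E 0) using 1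
  ext x
  simp

theorem singleton [FiniteDimensional ℝ E] (a : E) : SOCRepresentable {a} := by
  let e := Module.finBasis ℝ E
  convert iInter fun i => setOf_eq (e.coord i).toAffineMap (AffineMap.const ℝ E (e.coord i a))
    using 1
  ext x
  simp [e.ext_elem_iff]

end SOCRepresentable

end Algebra

theorem eq_zero_of_forall_add_smul_mem {E : Type*} [NormedAddCommGroup E] [NormedSpace ℝ E]
    {s : Set E} (hs : Bornology.IsBounded s) {x v : E} (h : ∀ t : ℝ, 0 ≤ t → x + t • v ∈ s) :
    v = 0 := by
  have hv : Filter.Tendsto (fun t : ℝ => x + t • v) Filter.atTop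
      (AffineSpace.asymptoticNhds ℝ E v) :=
    (Filter.tendsto_id.atTop_smul_const_tendsto_asymptoticNhds v).const_vadd_asymptoticNhds x
  exact asymptoticCone_subset_singleton_of_bounded hs
    (hv.frequently ((Filter.eventually_ge_atTop 0).mono h).frequently)

namespace SOCRepresentable

variable {E : Type*} [NormedAddCommGroup E] [NormedSpace ℝ E]

open scoped Pointwise in
theorem setOf_mem_smul {X : Set E} (hX : SOCRepresentable X) (hne : X.Nonempty)
    (hb : Bornology.IsBounded X) :
    SOCRepresentable {z : E × ℝ | 0 ≤ z.2 ∧ z.1 ∈ z.2 • X} := by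
  obtain ⟨p, k, m, F, rfl⟩ := hX
  let e : (E × ℝ) × (Fin p → ℝ) →ₗ[ℝ] (E × (Fin p → ℝ)) × ℝ :=
    (LinearMap.fst ℝ E ℝ).prodMap LinearMap.id |>.prod <|
      (LinearMap.snd ℝ E ℝ).comp (LinearMap.fst ℝ _ _)
  convert (setOf_le (AffineMap.const ℝ (E × ℝ) 0) (LinearMap.snd ℝ E ℝ).toAffineMap).inter
    (setOf_exists_forall_mem m fun j => ((homogenization (F j)).comp e).toAffineMap) using 1
  ext ⟨x, l⟩
  refine and_congr_right fun hl : 0 ≤ l => ?_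
  change _ ↔ ∃ u, ∀ j, homogenization (F j) ((x, u), l) ∈ _
  rcases hl.eq_or_lt with rfl | hl
  · simp only [Set.zero_smul_set hne, Set.mem_zero, homogenization_zero_right]
    constructor
    · rintro rfl
      exact ⟨0, fun j => by simp [← Prod.zero_eq_mk, zero_mem_secondOrderCone]⟩
    · rintro ⟨u, hu⟩
      obtain ⟨x₀, u₀, hu₀⟩ := hne
      refine eq_zero_of_forall_add_smul_mem hb (x := x₀) fun t ht => ⟨u₀ + t • u, fun j => ?_⟩
      have hF : F j ((x₀, u₀) + t • (x, u)) = t • (F j).linear (x, u) + F j (x₀, u₀) := by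
        rw [add_comm, ← map_smul]
        exact (F j).map_vadd (x₀, u₀) (t • (x, u))
      exact hF ▸ add_mem_secondOrderCone (smul_mem_secondOrderCone ht (hu j)) (hu₀ j)
  · obtain ⟨y, rfl⟩ : ∃ y, l • y = x := ⟨l⁻¹ • x, smul_inv_smul₀ hl.ne' x⟩
    rw [Set.smul_mem_smul_set_iff₀ hl.ne', (MulAction.surjective₀ hl.ne').exists]
    refine exists_congr fun u => forall_congr' fun j => ?_
    rw [← Prod.smul_mk, homogenization_smul, smul_mem_secondOrderCone_iff hl]

theorem convexJoin [FiniteDimensional ℝ E] {X Y : Set E} (hX : SOCRepresentable X)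
    (hY : SOCRepresentable Y) (hX₀ : X.Nonempty) (hY₀ : Y.Nonempty) (hXb : Bornology.IsBounded X)
    (hYb : Bornology.IsBounded Y) : SOCRepresentable (convexJoin ℝ X Y) := by
  let f : E × E × ℝ →ᵃ[ℝ] E × ℝ := (LinearMap.snd ℝ E (E × ℝ)).toAffineMap
  let g : E × E × ℝ →ᵃ[ℝ] E × ℝ := (LinearMap.fst ℝ E (E × ℝ)).toAffineMap.prod
    (AffineMap.const ℝ _ 1) - f
  convert (((hX.setOf_mem_smul hX₀ hXb).preimage f).inter
    ((hY.setOf_mem_smul hY₀ hYb).preimage g)).image_fst using 1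
  ext z
  simp only [mem_convexJoin, _root_.segment, Set.mem_image, Set.mem_inter_iff, Set.mem_preimage,
    Prod.exists, Set.mem_ofPred_eq, exists_and_right, exists_eq_right, Set.mem_smul_set]
  constructor
  · rintro ⟨x, hx, y, hy, a, b, ha, hb, hab, rfl⟩
    exact ⟨a • x, a, ⟨ha, x, hx, rfl⟩, by simp [f, g, ← hab, hb], y, hy, by simp [f, g, ← hab]⟩
  · rintro ⟨w, a, ⟨ha, x, hx, hw⟩, hb, y, hy, h⟩
    obtain rfl : a • x = w := hw
    exact ⟨x, hx, y, hy, a, 1 - a, ha, hb, add_sub_cancel _ _, eq_sub_iff_add_eq'.1 h⟩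

theorem convexHull_union [FiniteDimensional ℝ E] {X Y : Set E}
    (hX : SOCRepresentable (convexHull ℝ X)) (hY : SOCRepresentable (convexHull ℝ Y))
    (hXb : Bornology.IsBounded X) (hYb : Bornology.IsBounded Y) :
    SOCRepresentable (convexHull ℝ (X ∪ Y)) := by
  rcases X.eq_empty_or_nonempty with rfl | hX₀
  · rwa [Set.empty_union]
  rcases Y.eq_empty_or_nonempty with rfl | hY₀
  · rwa [Set.union_empty]
  rw [_root_.convexHull_union hX₀ hY₀]
  exact hX.convexJoin hY hX₀.convexHull hY₀.convexHull (isBounded_convexHull.2 hXb)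
    (isBounded_convexHull.2 hYb)

theorem convexHull_biUnion [FiniteDimensional ℝ E] {ι : Type*} {s : Set ι} (hs : s.Finite)
    {X : ι → Set E} (hX : ∀ i ∈ s, SOCRepresentable (convexHull ℝ (X i)))
    (hb : ∀ i ∈ s, Bornology.IsBounded (X i)) :
    SOCRepresentable (convexHull ℝ (⋃ i ∈ s, X i)) := by
  induction s, hs using Set.Finite.induction_on with
  | empty => simpa using empty
  | insert _ hs ih =>
    rw [Set.forall_mem_insert] at hX hb
    rw [Set.biUnion_insert]
    exact hX.1.convexHull_union (ih hX.2 hb.2) hb.1 ((Bornology.isBounded_biUnion hs).2 hb.2)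

theorem segment [FiniteDimensional ℝ E] (a b : E) : SOCRepresentable (segment ℝ a b) := by
  rw [← convexJoin_singletons]
  exact (singleton a).convexJoin (singleton b) (Set.singleton_nonempty a)
    (Set.singleton_nonempty b) Bornology.isBounded_singleton Bornology.isBounded_singleton

end SOCRepresentable

section Convexity

section Module

variable {E : Type*} [AddCommGroup E] [Module ℝ E]

theorem mem_segment_sub_smul_add_smul (x v : E) {s t : ℝ} (hs : 0 ≤ s) (ht : 0 ≤ t) :
    x ∈ segment ℝ (x - s • v) (x + t • v) := by
  rw [mem_segment_iff_sameRay, sub_sub_cancel, add_sub_cancel_left]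
  exact (SameRay.sameRay_nonneg_smul_left v hs).nonneg_smul_right ht

-- The directions from `z` into `C` generate a convex cone, which contains `0` only if `z ∈ C`.
theorem mem_of_mem_convexHull_of_add_smul_mem {s C : Set E} {z : E} (hC : Convex ℝ C)
    (hz : z ∈ convexHull ℝ s) (h : ∀ x ∈ s, ∃ t : ℝ, 0 < t ∧ z + t • (x - z) ∈ C) : z ∈ C := by
  have hC' : Convex ℝ ((z + ·) ⁻¹' C) := hC.translate_preimage_right z
  let K := ConvexCone.hull ℝ ((z + ·) ⁻¹' C)
  have hs : s ⊆ (-z + ·) ⁻¹' K := by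
    intro x hx
    obtain ⟨t, ht, hxC⟩ := h x hx
    have : t • (x - z) ∈ K := ConvexCone.subset_hull hxC
    have := K.smul_mem (inv_pos.2 ht) this
    rwa [inv_smul_smul₀ ht.ne', sub_eq_neg_add] at this
  have hzK : (0 : E) ∈ K := by
    simpa using convexHull_min hs (K.convex.translate_preimage_right (-z)) hz
  obtain ⟨r, hr, c, hc, hrc⟩ := (ConvexCone.mem_hull_of_convex hC').1 hzK
  obtain rfl : c = 0 := (smul_eq_zero_iff_right hr.ne').1 hrc
  simpa using hc

end Module

variable {E : Type*} [AddCommGroup E] [Module ℝ E] [TopologicalSpace E]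

theorem exists_convexHull_eq_segment {s : Set E} (hs : IsCompact s) (hne : s.Nonempty)
    (f : E →L[ℝ] ℝ) (hf : Set.InjOn f (convexHull ℝ s)) :
    ∃ p ∈ s, ∃ q ∈ s, convexHull ℝ s = segment ℝ p q := by
  obtain ⟨p, hp, hpmin⟩ := hs.exists_isMinOn hne f.continuous.continuousOn
  obtain ⟨q, hq, hqmax⟩ := hs.exists_isMaxOn hne f.continuous.continuousOn
  refine ⟨p, hp, q, hq, (convexHull_min ?_ (convex_segment p q)).antisymm
    (segment_subset_convexHull hp hq)⟩
  intro z hz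
  obtain ⟨y, hy, hyz⟩ : f z ∈ f '' segment ℝ p q := by
    have hpz : f p ≤ f z := hpmin hz
    have hzq : f z ≤ f q := hqmax hz
    exact (image_segment ℝ f.toLinearMap.toAffineMap p q).ge
      ((segment_eq_Icc (hpz.trans hzq)).ge ⟨hpz, hzq⟩)
  exact hf (segment_subset_convexHull hp hq hy) (subset_convexHull ℝ s hz) hyz ▸ hy

variable [ContinuousAdd E] [ContinuousSMul ℝ E]

theorem exists_pos_add_smul_mem_diff {K U : Set E} (hK : IsClosed K) (hU : IsOpen U)
    (hUK : U ⊆ K) {z x : E} (hz : z ∈ U) (hx : x ∉ U) :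
    ∃ t ∈ Set.Ioc (0 : ℝ) 1, z + t • (x - z) ∈ K \ U := by
  have hseg : (segment ℝ z x ∩ (K \ U)).Nonempty := by
    by_contra hempty
    have hcover : segment ℝ z x ⊆ U ∪ Kᶜ := fun y hy =>
      or_iff_not_imp_left.2 fun hyU hyK => hempty ⟨y, hy, hyK, hyU⟩
    exact hx ((convex_segment z x).isPreconnected.subset_left_of_subset_union hU hK.isOpen_compl
      (Set.disjoint_compl_right_iff_subset.2 hUK) hcover ⟨z, left_mem_segment ℝ z x, hz⟩
      (right_mem_segment ℝ z x))
  rw [segment_eq_image'] at hseg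
  obtain ⟨_, ⟨t, ht, rfl⟩, h⟩ := hseg
  refine ⟨t, ⟨ht.1.lt_of_ne ?_, ht.2⟩, h⟩
  rintro rfl
  exact h.2 (by simpa using hz)

theorem convexHull_inter_diff {D K U : Set E} (hD : Convex ℝ D) (hK : Convex ℝ K)
    (hKc : IsClosed K) (hU : IsOpen U) (hUK : U ⊆ K) :
    convexHull ℝ (D ∩ (K \ U)) = D ∩ K ∩ convexHull ℝ (Uᶜ ∩ D) := by
  refine (Set.subset_inter (convexHull_min ?_ (hD.inter hK)) (convexHull_mono ?_)).antisymm ?_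
  · exact Set.inter_subset_inter_right D Set.sdiff_subset
  · exact fun x hx => ⟨hx.2.2, hx.1⟩
  rintro z ⟨⟨hzD, hzK⟩, hz⟩
  by_cases hzU : z ∈ U
  · refine mem_of_mem_convexHull_of_add_smul_mem (convex_convexHull ℝ _) hz fun x hx => ?_
    obtain ⟨t, ht, hxKU⟩ := exists_pos_add_smul_mem_diff hKc hU hUK hzU hx.1
    have hxD : z + t • (x - z) ∈ D := hD.add_smul_sub_mem hzD hx.2 (Set.Ioc_subset_Icc_self ht)
    exact ⟨t, ht.1, subset_convexHull ℝ _ ⟨hxD, hxKU⟩⟩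
  · exact subset_convexHull ℝ _ ⟨hzD, hzK, hzU⟩

end Convexity

section Faces

variable {E ι : Type*} [AddCommGroup E] [Module ℝ E]

/-- The face of the polyhedron `{x | A x ≤ b}` on which the constraints in `I` are tight. Different
`I` may give the same face, and the face may be empty. -/
def polyhedralFace (A : E →ₗ[ℝ] ι → ℝ) (b : ι → ℝ) (I : Set ι) : Set E :=
  {x | A x ≤ b ∧ ∀ i ∈ I, A x i = b i}

/-- The directions parallel to the hyperplanes that cut out `polyhedralFace A b I`. This can be
larger than the direction of the affine span of the face. -/
def faceDirection (A : E →ₗ[ℝ] ι → ℝ) (I : Set ι) : Submodule ℝ E :=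
  (Submodule.pi I fun _ => ⊥).comap A

variable {A : E →ₗ[ℝ] ι → ℝ} {b : ι → ℝ} {I J : Set ι}

theorem mem_faceDirection {v : E} : v ∈ faceDirection A I ↔ ∀ i ∈ I, A v i = 0 := Iff.rfl

theorem sub_mem_faceDirection {x y : E} (hx : x ∈ polyhedralFace A b I)
    (hy : y ∈ polyhedralFace A b I) : x - y ∈ faceDirection A I := fun i hi => by
  simp [hx.2 i hi, hy.2 i hi]

theorem polyhedralFace_subset : polyhedralFace A b I ⊆ {x | A x ≤ b} := fun _ h => h.1

theorem polyhedralFace_anti (h : I ⊆ J) : polyhedralFace A b J ⊆ polyhedralFace A b I :=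
  fun _ hx => ⟨hx.1, fun i hi => hx.2 i (h hi)⟩

theorem polyhedralFace_eq_preimage (A : E →ₗ[ℝ] ι → ℝ) (b : ι → ℝ) (I : Set ι) :
    polyhedralFace A b I = A ⁻¹' (Set.Iic b ∩ I.pi fun i => {b i}) := rfl

theorem convex_polyhedralFace (A : E →ₗ[ℝ] ι → ℝ) (b : ι → ℝ) (I : Set ι) :
    Convex ℝ (polyhedralFace A b I) := by
  rw [polyhedralFace_eq_preimage]
  exact ((convex_Iic b).inter (convex_pi fun i _ => convex_singleton (b i))).linear_preimage A

theorem socRepresentable_polyhedralFace [Finite ι] (A : E →ₗ[ℝ] ι → ℝ) (b : ι → ℝ) (I : Set ι) :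
    SOCRepresentable (polyhedralFace A b I) := by
  let f (i : ι) : E →ᵃ[ℝ] ℝ := ((LinearMap.proj i).comp A).toAffineMap
  let c (i : ι) : E →ᵃ[ℝ] ℝ := AffineMap.const ℝ E (b i)
  convert (SOCRepresentable.iInter fun i => .setOf_le (f i) (c i)).inter
    (SOCRepresentable.iInter fun i : I => .setOf_eq (f i) (c i)) using 1
  ext x
  simp [polyhedralFace, Pi.le_def, f, c]

end Faces

section BoundedFaces

variable {E ι : Type*} [NormedAddCommGroup E] [NormedSpace ℝ E]
  {A : E →ₗ[ℝ] ι → ℝ} {b : ι → ℝ} {I : Set ι}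

theorem isClosed_polyhedralFace [FiniteDimensional ℝ E] (A : E →ₗ[ℝ] ι → ℝ) (b : ι → ℝ)
    (I : Set ι) : IsClosed (polyhedralFace A b I) := by
  rw [polyhedralFace_eq_preimage]
  exact (isClosed_Iic.inter (isClosed_set_pi fun _ _ => isClosed_singleton)).preimage
    A.continuous_of_finiteDimensional

theorem exists_map_apply_pos_of_isBounded (hP : Bornology.IsBounded {x | A x ≤ b}) {x v : E}
    (hx : A x ≤ b) (hv : v ≠ 0) : ∃ i, 0 < A v i := by
  by_contra! h
  refine hv (eq_zero_of_forall_add_smul_mem hP (x := x) fun t ht => ?_)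
  have htv : t • A v ≤ 0 := smul_nonpos_of_nonneg_of_nonpos ht h
  simpa using add_le_add hx htv

variable [Finite ι]

theorem exists_add_smul_mem_polyhedralFace_insert (hP : Bornology.IsBounded {x | A x ≤ b})
    {x v : E} (hx : x ∈ polyhedralFace A b I) (hv : v ≠ 0) (hvI : v ∈ faceDirection A I) :
    ∃ t : ℝ, 0 ≤ t ∧ ∃ i ∉ I, x + t • v ∈ polyhedralFace A b (insert i I) := by
  obtain ⟨i, hi, hmin⟩ := {i | 0 < A v i}.exists_min_image (fun i => (b i - A x i) / A v i)
    (Set.toFinite _) (exists_map_apply_pos_of_isBounded hP hx.1 hv)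
  replace hi : 0 < A v i := hi
  set t := (b i - A x i) / A v i with ht_def
  have ht : 0 ≤ t := div_nonneg (sub_nonneg.2 (hx.1 i)) hi.le
  have hti : A (x + t • v) i = b i := by
    simp [ht_def, div_mul_cancel₀ _ hi.ne']
  have htj (j : ι) (hj : j ∈ I) : A (x + t • v) j = b j := by
    simp [hx.2 j hj, mem_faceDirection.1 hvI j hj]
  refine ⟨t, ht, i, fun hiI => hi.ne' (hvI i hiI), fun j => ?_, Set.forall_mem_insert.2 ⟨hti, htj⟩⟩
  suffices t * A v j ≤ b j - A x j by simpa [add_comm, le_sub_iff_add_le] using this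
  rcases le_or_gt (A v j) 0 with hj | hj
  · exact (mul_nonpos_of_nonneg_of_nonpos ht hj).trans (sub_nonneg.2 (hx.1 j))
  · exact (le_div_iff₀ hj).1 (hmin j hj)

theorem mem_convexHull_of_line_mem (hP : Bornology.IsBounded {x | A x ≤ b}) {X : Set E}
    {x v : E} (hx : x ∈ polyhedralFace A b I) (hv : v ≠ 0) (hvI : v ∈ faceDirection A I)
    (hline : ∀ t : ℝ, x + t • v ∈ X) :
    x ∈ convexHull ℝ (⋃ i ∈ Iᶜ, X ∩ polyhedralFace A b (insert i I)) := by
  obtain ⟨s, hs, i, hi, hsi⟩ :=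
    exists_add_smul_mem_polyhedralFace_insert hP hx (neg_ne_zero.2 hv) (neg_mem hvI)
  obtain ⟨t, ht, j, hj, htj⟩ := exists_add_smul_mem_polyhedralFace_insert hP hx hv hvI
  rw [smul_neg, ← neg_smul] at hsi
  refine segment_subset_convexHull ?_ ?_ (mem_segment_sub_smul_add_smul x v hs ht)
  · rw [sub_eq_add_neg, ← neg_smul]
    exact Set.mem_biUnion (Set.mem_compl hi) ⟨hline (-s), hsi⟩
  · exact Set.mem_biUnion (Set.mem_compl hj) ⟨hline t, htj⟩

variable [FiniteDimensional ℝ E]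

theorem socRepresentable_convexHull_inter_polyhedralFace
    (hP : Bornology.IsBounded {x | A x ≤ b}) {X : Set E}
    (hX : ∀ I, SOCRepresentable (convexHull ℝ (X ∩ polyhedralFace A b I)) ∨
      ∀ x ∈ X ∩ polyhedralFace A b I, ∃ v ∈ faceDirection A I, v ≠ 0 ∧ ∀ t : ℝ, x + t • v ∈ X)
    (I : Set ι) : SOCRepresentable (convexHull ℝ (X ∩ polyhedralFace A b I)) := by
  induction I using WellFoundedGT.induction with
  | ind I ih =>
  refine (hX I).elim id fun hline => ?_
  have hunion : convexHull ℝ (X ∩ polyhedralFace A b I) =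
      convexHull ℝ (⋃ i ∈ Iᶜ, X ∩ polyhedralFace A b (insert i I)) := by
    refine (convexHull_min ?_ (convex_convexHull ℝ _)).antisymm (convexHull_mono ?_)
    · intro x hx
      obtain ⟨v, hvI, hv, hvX⟩ := hline x hx
      exact mem_convexHull_of_line_mem hP hx.2 hv hvI hvX
    · exact Set.iUnion₂_subset fun i _ =>
        Set.inter_subset_inter_right X (polyhedralFace_anti (Set.subset_insert i I))
  rw [hunion]
  exact SOCRepresentable.convexHull_biUnion (Set.toFinite _)
    (fun i hi => ih _ (Set.ssubset_insert hi))
    fun i _ => hP.subset (Set.inter_subset_right.trans polyhedralFace_subset)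

theorem socRepresentable_convexHull_compl_inter_polyhedralFace
    (hP : Bornology.IsBounded {x | A x ≤ b}) {U : Set E} (hU : IsOpen U) (hUc : Convex ℝ U)
    (I : Set ι) : SOCRepresentable (convexHull ℝ (Uᶜ ∩ polyhedralFace A b I)) := by
  refine socRepresentable_convexHull_inter_polyhedralFace hP (fun I => ?_) I
  by_cases hf : ∃ f : E →L[ℝ] ℝ, ∀ v ∈ faceDirection A I, f v = 0 → v = 0
  · left
    obtain ⟨f, hf⟩ := hf
    rcases (Uᶜ ∩ polyhedralFace A b I).eq_empty_or_nonempty with hempty | hne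
    · rw [hempty, convexHull_empty]
      exact .empty
    have hcompact : IsCompact (Uᶜ ∩ polyhedralFace A b I) :=
      Metric.isCompact_of_isClosed_isBounded
        (hU.isClosed_compl.inter (isClosed_polyhedralFace A b I))
        (hP.subset (Set.inter_subset_right.trans polyhedralFace_subset))
    have hsubset : convexHull ℝ (Uᶜ ∩ polyhedralFace A b I) ⊆ polyhedralFace A b I :=
      convexHull_min Set.inter_subset_right (convex_polyhedralFace A b I)
    have hinj : Set.InjOn f (convexHull ℝ (Uᶜ ∩ polyhedralFace A b I)) := fun x hx y hy hxy =>
      sub_eq_zero.1 (hf _ (sub_mem_faceDirection (hsubset hx) (hsubset hy)) (by simp [hxy]))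
    obtain ⟨p, -, q, -, hpq⟩ := exists_convexHull_eq_segment hcompact hne f hinj
    exact hpq ▸ .segment p q
  · right
    push Not at hf
    rintro x ⟨hxU, -⟩
    obtain ⟨f, hfx⟩ := geometric_hahn_banach_open_point hUc hU hxU
    obtain ⟨v, hvI, hfv, hv⟩ := hf f
    refine ⟨v, hvI, hv, fun t ht => ?_⟩
    simpa [hfv] using hfx _ ht

theorem socRepresentable_convexHull_polyhedralFace_inter_norm_eq
    (hP : Bornology.IsBounded {x | A x ≤ b}) {F : Type*} [NormedAddCommGroup F]
    [InnerProductSpace ℝ F] [FiniteDimensional ℝ F] (G : E →ᵃ[ℝ] F) (f : E →ᵃ[ℝ] ℝ) (I : Set ι) :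
    SOCRepresentable (convexHull ℝ (polyhedralFace A b I ∩ {x | ‖G x‖ = f x})) := by
  have hG : Continuous G := G.continuous_of_finiteDimensional
  have hf : Continuous f := f.continuous_of_finiteDimensional
  have hconvex : ConvexOn ℝ Set.univ fun x => ‖G x‖ - f x := by
    exact (convexOn_univ_norm.comp_affineMap G).sub
      ((LinearMap.id.concaveOn convex_univ).comp_affineMap f)
  have hU : IsOpen {x | ‖G x‖ < f x} := isOpen_lt hG.norm hf
  have hUc : Convex ℝ {x | ‖G x‖ < f x} := by simpa using hconvex.convex_lt 0
  have hK : IsClosed {x | ‖G x‖ ≤ f x} := isClosed_le hG.norm hf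
  have hKc : Convex ℝ {x | ‖G x‖ ≤ f x} := by simpa using hconvex.convex_le 0
  have hdiff : {x | ‖G x‖ = f x} = {x | ‖G x‖ ≤ f x} \ {x | ‖G x‖ < f x} := by
    ext x
    simp [le_antisymm_iff]
  have hUK : {x | ‖G x‖ < f x} ⊆ {x | ‖G x‖ ≤ f x} :=
    Set.ofPred_subset_ofPred.2 fun _ => le_of_lt
  rw [hdiff, convexHull_inter_diff (convex_polyhedralFace A b I) hKc hK hU hUK]
  exact ((socRepresentable_polyhedralFace A b I).inter (.setOf_norm_le G f)).inter
    (socRepresentable_convexHull_compl_inter_polyhedralFace hP hU hUc I)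

theorem socRepresentable_convexHull_polyhedralFace_inter_norm_sq_eq_sq
    (hP : Bornology.IsBounded {x | A x ≤ b}) {F : Type*} [NormedAddCommGroup F]
    [InnerProductSpace ℝ F] [FiniteDimensional ℝ F] (G : E →ᵃ[ℝ] F) (f : E →ᵃ[ℝ] ℝ) (I : Set ι) :
    SOCRepresentable (convexHull ℝ (polyhedralFace A b I ∩ {x | ‖G x‖ ^ 2 = f x ^ 2})) := by
  have hunion : {x | ‖G x‖ ^ 2 = f x ^ 2} = {x | ‖G x‖ = f x} ∪ {x | ‖G x‖ = (-f) x} :=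
    Set.ext fun x => sq_eq_sq_iff_eq_or_eq_neg
  have hbounded (X : Set E) : Bornology.IsBounded (polyhedralFace A b I ∩ X) :=
    hP.subset (Set.inter_subset_left.trans polyhedralFace_subset)
  rw [hunion, Set.inter_union_distrib_left]
  exact (socRepresentable_convexHull_polyhedralFace_inter_norm_eq hP G f I).convexHull_union
    (socRepresentable_convexHull_polyhedralFace_inter_norm_eq hP G (-f) I) (hbounded _) (hbounded _)

-- Since `4 f g = (f + g) ^ 2 - (f - g) ^ 2`, the equation says `‖(2 G, f - g)‖ ^ 2 = (f + g) ^ 2`.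
theorem socRepresentable_convexHull_polyhedralFace_inter_norm_sq_eq_mul
    (hP : Bornology.IsBounded {x | A x ≤ b}) {F : Type*} [NormedAddCommGroup F]
    [InnerProductSpace ℝ F] [FiniteDimensional ℝ F] (G : E →ᵃ[ℝ] F) (f g : E →ᵃ[ℝ] ℝ)
    (I : Set ι) :
    SOCRepresentable (convexHull ℝ (polyhedralFace A b I ∩ {x | ‖G x‖ ^ 2 = f x * g x})) := by
  let H : E →ᵃ[ℝ] WithLp 2 (F × ℝ) :=
    (WithLp.linearEquiv 2 ℝ (F × ℝ)).symm.toLinearMap.toAffineMap.comp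
      (((2 : ℝ) • G).prod (f - g))
  convert socRepresentable_convexHull_polyhedralFace_inter_norm_sq_eq_sq hP H (f + g) I using 5
    with x
  have hH : ‖H x‖ ^ 2 = 4 * ‖G x‖ ^ 2 + (f x - g x) ^ 2 := by
    calc ‖H x‖ ^ 2 = ‖(2 : ℝ) • G x‖ ^ 2 + ‖f x - g x‖ ^ 2 := WithLp.prod_norm_sq_eq_of_L2 _
      _ = 4 * ‖G x‖ ^ 2 + (f x - g x) ^ 2 := by
        rw [norm_smul, mul_pow, Real.norm_eq_abs, Real.norm_eq_abs, sq_abs, sq_abs]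
        norm_num
  rw [hH, AffineMap.coe_add, Pi.add_apply]
  constructor <;> intro h <;> linarith

end BoundedFaces

section QuadraticForm

theorem quadraticForm_add_linear_apply {M : Type*} [AddCommGroup M] [Module ℝ M]
    (q : QuadraticForm ℝ M) (ℓ : Module.Dual ℝ M) (x v : M) :
    q (x + v) + ℓ (x + v) = q x + ℓ x + (q v + (q.polarBilin x + ℓ) v) := by
  rw [QuadraticMap.map_add q, map_add ℓ, LinearMap.add_apply, QuadraticMap.polarBilin_apply_apply]
  ring

theorem posDef_or_posDef_neg_of_anisotropic {M : Type*} [AddCommGroup M] [Module ℝ M]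
    {q : QuadraticForm ℝ M} (hq : q.Anisotropic) : q.PosDef ∨ (-q).PosDef := by
  by_contra! h
  simp only [QuadraticMap.PosDef, neg_apply, not_forall, not_lt] at h
  obtain ⟨⟨u, hu₀, hu⟩, v, hv₀, hv⟩ := h
  replace hu : q u < 0 := hu.lt_of_ne (mt (hq u) hu₀)
  replace hv : 0 < q v := (neg_nonpos.1 hv).lt_of_ne' (mt (hq v) hv₀)
  have hline (t : ℝ) : q (u + t • v) = q v * (t * t) + QuadraticMap.polar q u v * t + q u := by
    rw [QuadraticMap.map_add q, QuadraticMap.map_smul, QuadraticMap.polar_smul_right, smul_eq_mul,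
      smul_eq_mul]
    ring
  have hdiscrim : 0 ≤ discrim (q v) (QuadraticMap.polar q u v) (q u) := by
    rw [discrim]
    nlinarith [sq_nonneg (QuadraticMap.polar q u v), mul_neg_of_pos_of_neg hv hu]
  obtain ⟨t, ht⟩ := exists_quadratic_eq_zero hv.ne' ⟨_, (Real.mul_self_sqrt hdiscrim).symm⟩
  have huv : u = -(t • v) := eq_neg_of_add_eq_zero_left (hq _ ((hline t).trans ht))
  rw [huv, QuadraticMap.map_neg, QuadraticMap.map_smul, smul_eq_mul] at hu
  exact hu.not_ge (mul_nonneg (mul_self_nonneg t) hv.le)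

theorem exists_norm_sq_eq_of_nonneg {M : Type*} [AddCommGroup M] [Module ℝ M]
    [FiniteDimensional ℝ M] {q : QuadraticForm ℝ M} (hq : ∀ v, 0 ≤ q v) :
    ∃ L : M →ₗ[ℝ] EuclideanSpace ℝ (Fin (Module.finrank ℝ M)), ∀ v, ‖L v‖ ^ 2 = q v := by
  obtain ⟨w, ⟨e⟩⟩ := q.equivalent_weightedSumSquares
  have hw (i) : 0 ≤ w i := by
    simpa [QuadraticMap.weightedSumSquares_apply, Pi.single_apply] using
      (hq (e.symm (Pi.single i 1))).trans_eq (e.symm.map_app _)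
  let D : (Fin (Module.finrank ℝ M) → ℝ) →ₗ[ℝ] (Fin (Module.finrank ℝ M) → ℝ) :=
    LinearMap.pi fun i => √(w i) • LinearMap.proj i
  refine ⟨(WithLp.linearEquiv 2 ℝ _).symm.toLinearMap ∘ₗ D ∘ₗ e.toLinearEquiv.toLinearMap,
    fun v => ?_⟩
  rw [← e.map_app v, EuclideanSpace.norm_sq_eq, QuadraticMap.weightedSumSquares_apply]
  refine Finset.sum_congr rfl fun i _ => ?_
  change ‖√(w i) * e v i‖ ^ 2 = w i * (e v i * e v i)
  rw [Real.norm_eq_abs, sq_abs, mul_pow, Real.sq_sqrt (hw i), sq (e v i)]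

variable {E : Type*} [NormedAddCommGroup E] [NormedSpace ℝ E]

theorem posDef_of_forall_mem_sphere {q : QuadraticForm ℝ E}
    (hq : ∀ v ∈ Metric.sphere (0 : E) 1, 0 < q v) : q.PosDef := by
  intro v hv
  have hv' : 0 < ‖v‖ := norm_pos_iff.2 hv
  have h := hq (‖v‖⁻¹ • v) (by simp [norm_smul, hv'.ne'])
  rw [QuadraticMap.map_smul] at h
  exact pos_of_mul_pos_right h (mul_self_nonneg _)

variable [FiniteDimensional ℝ E]

theorem continuous_quadraticForm (q : QuadraticForm ℝ E) : Continuous q := by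
  let B := q.associated.toContinuousBilinearMap
  have hB : ⇑q = fun x => B x x :=
    funext fun x => (QuadraticMap.associated_eq_self_apply ℝ q x).symm
  rw [hB]
  exact B.continuous.clm_apply continuous_id

theorem exists_posDef_add_smul {p q : QuadraticForm ℝ E} (hp : ∀ v, 0 ≤ p v)
    (hpq : ∀ v, v ≠ 0 → p v = 0 → 0 < q v) : ∃ μ : ℝ, (q + μ • p).PosDef := by
  let U (μ : ℝ) : Set E := {v | 0 < (q + μ • p) v}
  have hUo (μ : ℝ) : IsOpen (U μ) := isOpen_lt continuous_const (continuous_quadraticForm _)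
  have hU : Monotone U := fun μ ν h v hv =>
    hv.trans_le (add_le_add_right (mul_le_mul_of_nonneg_right h (hp v)) (q v))
  have hcover : Metric.sphere (0 : E) 1 ⊆ ⋃ μ, U μ := by
    intro v hv
    rw [Set.mem_iUnion]
    rcases (hp v).eq_or_lt with hpv | hpv
    · have hv₀ : v ≠ 0 := ne_zero_of_mem_unit_sphere ⟨v, hv⟩
      exact ⟨0, by simpa [U] using hpq v hv₀ hpv.symm⟩
    · exact ⟨(1 - q v) / p v, by simp [U, div_mul_cancel₀ _ hpv.ne']⟩
  obtain ⟨μ, hμ⟩ := (isCompact_sphere (0 : E) 1).elim_directed_cover U hUo hcover hU.directed_le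
  exact ⟨μ, posDef_of_forall_mem_sphere fun v hv => hμ hv⟩

theorem exists_norm_sq_eq_add_mul_sq {V : Submodule ℝ E} {q : QuadraticForm ℝ E}
    {w : Module.Dual ℝ E} (hq : ∀ v ∈ V, v ≠ 0 → w v = 0 → 0 < q v) :
    ∃ (μ : ℝ) (n : ℕ) (L : E →ₗ[ℝ] EuclideanSpace ℝ (Fin n)),
      ∀ v ∈ V, ‖L v‖ ^ 2 = q v + μ * (w v * w v) := by
  let p : QuadraticForm ℝ V := (QuadraticMap.linMulLin w w).comp V.subtype
  obtain ⟨μ, hμ⟩ := exists_posDef_add_smul (p := p) (q := q.comp V.subtype)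
    (fun v => mul_self_nonneg (w v))
    fun v hv hpv => hq v v.2 (fun h => hv (Subtype.ext h)) (mul_self_eq_zero.1 hpv)
  obtain ⟨L, hL⟩ := exists_norm_sq_eq_of_nonneg hμ.nonneg
  obtain ⟨L', rfl⟩ := L.exists_extend
  exact ⟨μ, _, L', fun v hv => hL ⟨v, hv⟩⟩

end QuadraticForm

section Quadric

variable {E ι : Type*} [NormedAddCommGroup E] [NormedSpace ℝ E] [FiniteDimensional ℝ E] [Finite ι]
  {A : E →ₗ[ℝ] ι → ℝ} {b : ι → ℝ}

theorem socRepresentable_convexHull_quadric_inter_of_pos (hP : Bornology.IsBounded {x | A x ≤ b})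
    {q : QuadraticForm ℝ E} {w : Module.Dual ℝ E} {I : Set ι} {x₀ : E}
    (hx₀ : x₀ ∈ polyhedralFace A b I)
    (hq : ∀ v ∈ faceDirection A I, v ≠ 0 → w v = 0 → 0 < q v) :
    SOCRepresentable
      (convexHull ℝ ({x | q (x - x₀) + w (x - x₀) = 0} ∩ polyhedralFace A b I)) := by
  obtain ⟨μ, n, L, hL⟩ := exists_norm_sq_eq_add_mul_sq hq
  let d : E →ᵃ[ℝ] E := AffineMap.id ℝ E - AffineMap.const ℝ E x₀
  let f : E →ᵃ[ℝ] ℝ := w.toAffineMap.comp d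
  convert socRepresentable_convexHull_polyhedralFace_inter_norm_sq_eq_mul hP
    (L.toAffineMap.comp d) f (μ • f - AffineMap.const ℝ E 1) I using 2
  rw [Set.inter_comm]
  ext x
  refine and_congr_right fun hx => ?_
  have hLx : ‖L (x - x₀)‖ ^ 2 = _ := hL _ (sub_mem_faceDirection hx hx₀)
  change q (x - x₀) + w (x - x₀) = 0 ↔
    ‖L (x - x₀)‖ ^ 2 = w (x - x₀) * (μ * w (x - x₀) - 1)
  rw [hLx]
  constructor <;> intro h <;> linarith

theorem socRepresentable_convexHull_quadric_inter_of_anisotropic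
    (hP : Bornology.IsBounded {x | A x ≤ b}) {q : QuadraticForm ℝ E} {w : Module.Dual ℝ E}
    {I : Set ι} {x₀ : E} (hx₀ : x₀ ∈ polyhedralFace A b I)
    (hq : ∀ v ∈ faceDirection A I, w v = 0 → q v = 0 → v = 0) :
    SOCRepresentable
      (convexHull ℝ ({x | q (x - x₀) + w (x - x₀) = 0} ∩ polyhedralFace A b I)) := by
  let V := faceDirection A I ⊓ LinearMap.ker w
  have hV : (q.comp V.subtype).Anisotropic := fun v hv => Subtype.ext (hq v v.2.1 v.2.2 hv)
  rcases posDef_or_posDef_neg_of_anisotropic hV with hpos | hneg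
  · refine socRepresentable_convexHull_quadric_inter_of_pos hP hx₀ fun v hv hv₀ hwv => ?_
    exact hpos ⟨v, hv, hwv⟩ (mt (congrArg Subtype.val) hv₀)
  · have h := socRepresentable_convexHull_quadric_inter_of_pos (q := -q) (w := -w) hP hx₀
      fun v hv hv₀ hwv => hneg ⟨v, hv, neg_eq_zero.1 hwv⟩ (mt (congrArg Subtype.val) hv₀)
    simpa only [neg_apply, LinearMap.neg_apply, ← neg_add, neg_eq_zero] using h

end Quadric

theorem theorem1_general {E ι : Type*} [NormedAddCommGroup E] [NormedSpace ℝ E]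
    [FiniteDimensional ℝ E] [Finite ι] (q : QuadraticForm ℝ E) (ℓ : Module.Dual ℝ E) (g : ℝ)
    (A : E →ₗ[ℝ] ι → ℝ) (b : ι → ℝ) (hP : Bornology.IsBounded {x | A x ≤ b}) :
    SOCRepresentable (convexHull ℝ {x | q x + ℓ x = g ∧ A x ≤ b}) := by
  let X := {x | q x + ℓ x = g}
  have hface : {x | q x + ℓ x = g ∧ A x ≤ b} = X ∩ polyhedralFace A b ∅ := by
    ext x
    simp [polyhedralFace, X]
  rw [hface]
  refine socRepresentable_convexHull_inter_polyhedralFace hP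
    (fun I => or_iff_not_imp_right.2 fun hline => ?_) ∅
  push Not at hline
  obtain ⟨x₀, ⟨hg, hx₀⟩, hx₀line⟩ := hline
  rw [Set.mem_ofPred_eq] at hg
  let w := q.polarBilin x₀ + ℓ
  have hX (v : E) : x₀ + v ∈ X ↔ q v + w v = 0 := by
    rw [Set.mem_ofPred_eq, quadraticForm_add_linear_apply, hg, add_eq_left]
  have hX' : X = {x | q (x - x₀) + w (x - x₀) = 0} := by
    ext x
    simpa using hX (x - x₀)
  rw [hX']
  refine socRepresentable_convexHull_quadric_inter_of_anisotropic hP hx₀ fun v hv hwv hqv => ?_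
  by_contra hv₀
  obtain ⟨t, ht⟩ := hx₀line v hv hv₀
  exact ht ((hX _).2 (by simp [QuadraticMap.map_smul, hqv, hwv]))

theorem theorem1 (n m : ℕ) (Q : Matrix (Fin n) (Fin n) ℝ) (hQ : Q.IsSymm)
    (α : Fin n → ℝ) (g : ℝ) (A : Matrix (Fin m) (Fin n) ℝ) (b : Fin m → ℝ)
    (hP : Bornology.IsBounded {x : Fin n → ℝ | A *ᵥ x ≤ b}) :
    IsSOCRepresentable
      (convexHull ℝ {x : Fin n → ℝ | x ⬝ᵥ Q *ᵥ x + α ⬝ᵥ x = g ∧ A *ᵥ x ≤ b}) := by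
  change SOCRepresentable _
  simpa [Matrix.toQuadraticForm', Matrix.toLinearMap₂'_apply'] using
    theorem1_general Q.toQuadraticForm' (dotProductBilin ℝ ℝ α) g A.mulVecLin b hP
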